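/- Let $(M,\tau)$ be a tracial $W^*$-probability space, i.e. $M$ is a von Neumann algebra and $\tau$ is a faithful normal tracial state on $M$, and let $X_1,\dots,X_n\in M$ be self-adjoint. Let $\mathbb{C}\langle Z_1,\dots,Z_n\rangle$ be the algebra of non-commutative polynomials, write $P(X)$ for the evaluation of $P$ at $Z_i\mapsto X_i$ (and likewise for elements of $\mathbb{C}\langle Z_1,\dots,Z_n\rangle^{\otimes 2}$), and let $\partial_j:\mathbb{C}\langle Z_1,\dots,Z_n\rangle\to\mathbb{C}\langle Z_1,\dots,Z_n\rangle^{\otimes 2}$ be the linear map determined by $\partial_jZ_i=\delta_{ij}\,1\otimes1$ and $\partial_j(P_1P_2)=(\partial_jP_1)(1\otimes P_2)+(P_1\otimes1)(\partial_jP_2)$. Let $L^2(X_1,\dots,X_n,\tau)$ be the closure of $\{P(X): P\in\mathbb{C}\langle Z_1,\dots,Z_n\rangle\}$ in $L^2(M,\tau)$. A conjugate system for $(X_1,\dots,X_n)$ is a tuple $(\xi_1,\dots,\xi_n)$ in $L^2(X_1,\dots,X_n,\tau)$ with $$(\tau\otimes\tau)\big((\partial_jP)(X)\big)=\tau(\xi_jP(X))\qquad\text{for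 all }P\in\mathbb{C}\langle Z_1,\dots,Z_n\rangle,\ j=1,\dots,n;$$ it is unique if it exists. The free Fisher information is $\Phi^*(X_1,\dots,X_n)=\sum_{j=1}^n\|\xi_j\|_2^2$ if a conjugate system exists, and $\Phi^*(X_1,\dots,X_n)=\infty$ otherwise. Let $\operatorname{vN}(X_1,\dots,X_n)\subseteq M$ be the von Neumann subalgebra generated by $X_1,\dots,X_n$. Assume that $\Phi^*(X_1,\dots,X_n)<\infty$, and let $P\in\mathbb{C}\langle Z_1,\dots,Z_n\rangle$ be non-zero. Then there is no non-zero self-adjoint $w\in\operatorname{vN}(X_1,\dots,X_n)$ with $P(X)w=0$. Consequently, every $w\in\operatorname{vN}(X_1,\dots,X_n)$, self-adjoint or not, with $P(X)w=0$ is zero. -/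

import Mathlib

open scoped TensorProduct ComplexOrder

noncomputable section

namespace FreeFisher

/-! ### Non-commutative polynomials and the non-commutative derivatives -/

/-- The algebra `ℂ⟨Z₁, …, Zₙ⟩` of non-commutative polynomials in `n` formal variables. -/
abbrev NCPoly (n : ℕ) : Type := FreeAlgebra ℂ (Fin n)

/-- The algebra homomorphism into `2 × 2` matrices over `ℂ⟨Z⟩ ⊗ ℂ⟨Z⟩` sending `Zᵢ` to the matrix
with rows `(Zᵢ ⊗ 1, δᵢⱼ 1 ⊗ 1)` and `(0, 1 ⊗ Zᵢ)`. Its upper right entry is the derivation `∂ⱼ`. -/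
def derivMatrix {n : ℕ} (j : Fin n) :
    NCPoly n →ₐ[ℂ] Matrix (Fin 2) (Fin 2) (NCPoly n ⊗[ℂ] NCPoly n) :=
  FreeAlgebra.lift ℂ fun i =>
    !![FreeAlgebra.ι ℂ i ⊗ₜ[ℂ] 1, if i = j then 1 else 0; 0, 1 ⊗ₜ[ℂ] FreeAlgebra.ι ℂ i]

/-- The non-commutative derivative `∂ⱼ : ℂ⟨Z⟩ → ℂ⟨Z⟩ ⊗ ℂ⟨Z⟩`. The lemmas `ncDeriv_ι`,
`ncDeriv_mul` and `ncDeriv_unique` say that it is the unique derivation with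
`∂ⱼ Zᵢ = δᵢⱼ 1 ⊗ 1`. -/
def ncDeriv {n : ℕ} (j : Fin n) : NCPoly n →ₗ[ℂ] NCPoly n ⊗[ℂ] NCPoly n where
  toFun P := derivMatrix j P 0 1
  map_add' P Q := by simp
  map_smul' c P := by simp

theorem ncDeriv_ι {n : ℕ} (j i : Fin n) :
    ncDeriv j (FreeAlgebra.ι ℂ i) = if i = j then 1 else 0 := by
  simp [ncDeriv, derivMatrix]

theorem derivMatrix_diag {n : ℕ} (j : Fin n) (P : NCPoly n) :
    derivMatrix j P 0 0 = P ⊗ₜ[ℂ] 1 ∧ derivMatrix j P 1 1 = 1 ⊗ₜ[ℂ] P ∧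
      derivMatrix j P 1 0 = 0 := by
  induction P using FreeAlgebra.induction with
  | grade0 c =>
    simp only [AlgHom.commutes, Matrix.algebraMap_matrix_apply]
    refine ⟨by simp, ?_, by simp⟩
    simp [Algebra.algebraMap_eq_smul_one, Algebra.TensorProduct.one_def]
  | grade1 i => simp [derivMatrix]
  | mul P Q hP hQ =>
    obtain ⟨p1, p2, p3⟩ := hP
    obtain ⟨q1, q2, q3⟩ := hQ
    simp [Matrix.mul_apply, Fin.sum_univ_two, p1, p2, p3, q1, q2, q3]
  | add P Q hP hQ =>
    obtain ⟨p1, p2, p3⟩ := hP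
    obtain ⟨q1, q2, q3⟩ := hQ
    simp [p1, p2, p3, q1, q2, q3, TensorProduct.add_tmul, TensorProduct.tmul_add]

theorem ncDeriv_mul {n : ℕ} (j : Fin n) (P Q : NCPoly n) :
    ncDeriv j (P * Q) = ncDeriv j P * (1 ⊗ₜ[ℂ] Q) + (P ⊗ₜ[ℂ] 1) * ncDeriv j Q := by
  have h1 := (derivMatrix_diag j P).1
  have h2 := (derivMatrix_diag j Q).2.1
  simp [ncDeriv, Matrix.mul_apply, Fin.sum_univ_two, h1, h2, add_comm]

theorem ncDeriv_unique {n : ℕ} (j : Fin n) (D : NCPoly n →ₗ[ℂ] NCPoly n ⊗[ℂ] NCPoly n)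
    (hι : ∀ i, D (FreeAlgebra.ι ℂ i) = if i = j then 1 else 0)
    (hmul : ∀ P Q, D (P * Q) = D P * (1 ⊗ₜ[ℂ] Q) + (P ⊗ₜ[ℂ] 1) * D Q) :
    D = ncDeriv j := by
  have key : ∀ E : NCPoly n →ₗ[ℂ] NCPoly n ⊗[ℂ] NCPoly n,
      (∀ P Q, E (P * Q) = E P * (1 ⊗ₜ[ℂ] Q) + (P ⊗ₜ[ℂ] 1) * E Q) → E 1 = 0 := by
    intro E hE
    have h := hE 1 1
    rw [← Algebra.TensorProduct.one_def, mul_one, mul_one, one_mul] at h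
    exact left_eq_add.mp h
  ext P
  induction P using FreeAlgebra.induction with
  | grade0 c =>
    rw [Algebra.algebraMap_eq_smul_one, map_smul, map_smul, key D hmul,
      key _ (ncDeriv_mul j)]
  | grade1 i => rw [hι, ncDeriv_ι]
  | mul P Q hP hQ => rw [hmul, ncDeriv_mul, hP, hQ]
  | add P Q hP hQ => rw [map_add, map_add, hP, hQ]

/-! ### Von Neumann algebras and tracial states -/

variable {H : Type*} [NormedAddCommGroup H] [InnerProductSpace ℂ H] [CompleteSpace H]

/-- The von Neumann algebra generated by a set `S` of bounded operators: the double commutant of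
`S ∪ S*`. By `vNGen_le_iff` it is the smallest von Neumann algebra that contains `S`. -/
def vNGen (S : Set (H →L[ℂ] H)) : VonNeumannAlgebra H where
  toStarSubalgebra :=
    StarSubalgebra.centralizer ℂ (StarSubalgebra.centralizer ℂ S : Set (H →L[ℂ] H))
  centralizer_centralizer' := by
    change Set.centralizer (Set.centralizer
      (StarSubalgebra.centralizer ℂ
        (StarSubalgebra.centralizer ℂ S : Set (H →L[ℂ] H)) : Set (H →L[ℂ] H))) =
      (StarSubalgebra.centralizer ℂ
        (StarSubalgebra.centralizer ℂ S : Set (H →L[ℂ] H)) : Set (H →L[ℂ] H))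
    rw [StarSubalgebra.coe_centralizer]
    exact Set.centralizer_centralizer_centralizer _

theorem coe_vNGen (S : Set (H →L[ℂ] H)) :
    (vNGen S : Set (H →L[ℂ] H)) = Set.centralizer (Set.centralizer (S ∪ star S)) := by
  change ((StarSubalgebra.centralizer ℂ
    (StarSubalgebra.centralizer ℂ S : Set (H →L[ℂ] H)) : StarSubalgebra ℂ (H →L[ℂ] H)) :
      Set (H →L[ℂ] H)) = _
  rw [StarSubalgebra.coe_centralizer_centralizer]

theorem vNGen_le_iff (S : Set (H →L[ℂ] H)) (N : VonNeumannAlgebra H) :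
    vNGen S ≤ N ↔ S ⊆ N := by
  rw [← SetLike.coe_subset_coe, coe_vNGen]
  constructor
  · exact fun h => (Set.subset_union_left.trans Set.subset_centralizer_centralizer).trans h
  · intro h
    rw [← N.centralizer_centralizer]
    refine Set.centralizer_subset (Set.centralizer_subset (Set.union_subset h ?_))
    intro x hx
    have : star x ∈ N := h hx
    simpa using star_mem this

/-- A faithful normal tracial state on the von Neumann algebra `M`, so that `(M, τ)` is a tracial
`W*`-probability space. Normality is stated as ultraweak continuity: `τ` is the restriction to `M`
of a functional `x ↦ ∑ₖ ⟨x ηₖ, ξₖ⟩` with `∑ₖ ‖ξₖ‖² < ∞` and `∑ₖ ‖ηₖ‖² < ∞`. -/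
structure TracialState (M : VonNeumannAlgebra H) where
  toLinearMap : M.toStarSubalgebra →ₗ[ℂ] ℂ
  map_one : toLinearMap 1 = 1
  nonneg : ∀ x, 0 ≤ toLinearMap (star x * x)
  faithful : ∀ x, toLinearMap (star x * x) = 0 → x = 0
  tracial : ∀ x y, toLinearMap (x * y) = toLinearMap (y * x)
  normal : ∃ ξ η : ℕ → H, (Summable fun k => ‖ξ k‖ ^ 2) ∧ (Summable fun k => ‖η k‖ ^ 2) ∧
    ∀ x : M.toStarSubalgebra,
      HasSum (fun k => inner ℂ (ξ k) ((x : H →L[ℂ] H) (η k))) (toLinearMap x)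

variable {M : VonNeumannAlgebra H}

/-! ### The Hilbert space `L²(M, τ)` -/

theorem TracialState.map_star (τ : TracialState M) (x : M.toStarSubalgebra) :
    τ.toLinearMap (star x) = star (τ.toLinearMap x) := by
  have im0 : ∀ y, (τ.toLinearMap (star y * y)).im = 0 := fun y =>
    (Complex.nonneg_iff.mp (τ.nonneg y)).2.symm
  have h1 := im0 (1 + x)
  have h2 := im0 (1 + Complex.I • x)
  have h3 := im0 x
  have e1 : star (1 + x) * (1 + x) = 1 + x + star x + star x * x := by
    rw [star_add, star_one]; noncomm_ring
  have e2 : star (1 + Complex.I • x) * (1 + Complex.I • x) =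
      1 + Complex.I • x - Complex.I • star x + star x * x := by
    rw [star_add, star_one, star_smul]
    simp only [add_mul, mul_add, one_mul, mul_one, smul_mul_smul_comm]
    simp [sub_eq_add_neg]
    abel
  rw [e1] at h1
  rw [e2] at h2
  simp only [map_add, map_sub, map_smul, τ.map_one, Complex.add_im, Complex.sub_im, Complex.one_im,
    smul_eq_mul, Complex.I_mul_im, h3] at h1 h2
  apply Complex.ext
  · simp; linarith
  · simp; linarith

/-- A copy of `M`, to carry the inner product `⟨x, y⟩ = τ(x* y)`. -/
def TracialState.PreL2 (_τ : TracialState M) : Type _ := M.toStarSubalgebra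

instance (τ : TracialState M) : AddCommGroup τ.PreL2 :=
  inferInstanceAs (AddCommGroup M.toStarSubalgebra)

instance (τ : TracialState M) : Module ℂ τ.PreL2 :=
  inferInstanceAs (Module ℂ M.toStarSubalgebra)

/-- The inner product on `M`, linear in the second variable (Mathlib's convention):
`⟨x, y⟩ = τ(x* y) = τ(y x*)`. -/
@[reducible] def TracialState.core (τ : TracialState M) : InnerProductSpace.Core ℂ τ.PreL2 where
  inner (x y : M.toStarSubalgebra) := τ.toLinearMap (star x * y)
  conj_inner_symm (x y : M.toStarSubalgebra) := by
    change star (τ.toLinearMap (star y * x)) = τ.toLinearMap (star x * y)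
    rw [← τ.map_star]; simp
  re_inner_nonneg (x : M.toStarSubalgebra) := (Complex.nonneg_iff.mp (τ.nonneg x)).1
  add_left (x y z : M.toStarSubalgebra) := by
    change τ.toLinearMap (star (x + y) * z) = _
    rw [star_add, add_mul, map_add]
  smul_left (x y : M.toStarSubalgebra) (r : ℂ) := by
    change τ.toLinearMap (star (r • x) * y) = _
    rw [star_smul, smul_mul_assoc, map_smul]; rfl
  definite (x : M.toStarSubalgebra) h := τ.faithful x h

instance (τ : TracialState M) : NormedAddCommGroup τ.PreL2 :=
  τ.core.toNormedAddCommGroup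

instance (τ : TracialState M) : InnerProductSpace ℂ τ.PreL2 :=
  InnerProductSpace.ofCore τ.core.toCore

/-- The Hilbert space `L²(M, τ)`: the completion of `M` for `⟨x, y⟩ = τ(x* y)`. -/
abbrev TracialState.L2 (τ : TracialState M) : Type _ := UniformSpace.Completion τ.PreL2

/-- The canonical embedding `M → L²(M, τ)`. -/
def TracialState.toL2 (τ : TracialState M) : M.toStarSubalgebra →ₗ[ℂ] τ.L2 where
  toFun x := ((show τ.PreL2 from x) : τ.L2)
  map_add' x y := UniformSpace.Completion.coe_add (α := τ.PreL2) x y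
  map_smul' c x := UniformSpace.Completion.coe_smul (X := τ.PreL2) c x

theorem TracialState.inner_toL2 (τ : TracialState M) (x y : M.toStarSubalgebra) :
    inner ℂ (τ.toL2 x) (τ.toL2 y) = τ.toLinearMap (star x * y) :=
  UniformSpace.Completion.inner_coe (E := τ.PreL2) x y

/-- The number `τ(ξ a)` for `ξ ∈ L²(M, τ)` and `a ∈ M`: the inner product of `ξ` with `a*`. -/
def TracialState.trMul (τ : TracialState M) (ξ : τ.L2) (a : M.toStarSubalgebra) : ℂ :=
  inner ℂ (τ.toL2 (star a)) ξ

theorem TracialState.trMul_toL2 (τ : TracialState M) (x a : M.toStarSubalgebra) :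
    τ.trMul (τ.toL2 x) a = τ.toLinearMap (x * a) := by
  rw [trMul, inner_toL2, star_star, τ.tracial]

/-! ### Conjugate systems and free Fisher information -/

/-- The evaluation homomorphism `P ↦ P(X₁, …, Xₙ)`. -/
def ev {n : ℕ} (X : Fin n → M.toStarSubalgebra) : NCPoly n →ₐ[ℂ] M.toStarSubalgebra :=
  FreeAlgebra.lift ℂ X

/-- The functional `τ ⊗ τ` on the algebraic tensor product `M ⊗ M`. -/
def TracialState.tensor (τ : TracialState M) :
    M.toStarSubalgebra ⊗[ℂ] M.toStarSubalgebra →ₗ[ℂ] ℂ :=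
  LinearMap.mul' ℂ ℂ ∘ₗ TensorProduct.map τ.toLinearMap τ.toLinearMap

/-- `L²(X₁, …, Xₙ, τ)`: the closure in `L²(M, τ)` of the polynomials in `X₁, …, Xₙ`. -/
def TracialState.L2Gen (τ : TracialState M) {n : ℕ} (X : Fin n → M.toStarSubalgebra) :
    Submodule ℂ τ.L2 :=
  (LinearMap.range (τ.toL2 ∘ₗ (ev X).toLinearMap)).topologicalClosure

/-- `(ξ₁, …, ξₙ)` satisfies the conjugate relations for `(X₁, …, Xₙ)`:
`(τ ⊗ τ)((∂ⱼ P)(X)) = τ(ξⱼ P(X))` for all `P` and `j`. -/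
def ConjugateRelations (τ : TracialState M) {n : ℕ} (X : Fin n → M.toStarSubalgebra)
    (ξ : Fin n → τ.L2) : Prop :=
  ∀ (P : NCPoly n) (j : Fin n),
    τ.tensor (Algebra.TensorProduct.map (ev X) (ev X) (ncDeriv j P)) = τ.trMul (ξ j) (ev X P)

/-- `(ξ₁, …, ξₙ)` is the conjugate system for `(X₁, …, Xₙ)`. -/
structure IsConjugateSystem (τ : TracialState M) {n : ℕ} (X : Fin n → M.toStarSubalgebra)
    (ξ : Fin n → τ.L2) : Prop where
  relations : ConjugateRelations τ X ξ
  mem_L2Gen : ∀ j, ξ j ∈ τ.L2Gen X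

open Classical in
/-- The non-microstates free Fisher information `Φ*(X₁, …, Xₙ)`: it is `∑ⱼ ‖ξⱼ‖₂²` if there is a
conjugate system `(ξ₁, …, ξₙ)` for `(X₁, …, Xₙ)`, and `∞` otherwise. -/
def fisherInformation (τ : TracialState M) {n : ℕ} (X : Fin n → M.toStarSubalgebra) : ENNReal :=
  if h : ∃ ξ : Fin n → τ.L2, IsConjugateSystem τ X ξ then
    ∑ j, ENNReal.ofReal (‖h.choose j‖ ^ 2)
  else ⊤

theorem ev_star {n : ℕ} (X : Fin n → M.toStarSubalgebra) (hX : ∀ i, IsSelfAdjoint (X i))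
    (P : NCPoly n) : ∃ Q : NCPoly n, star (ev X Q) = ev X P := by
  induction P using FreeAlgebra.induction with
  | grade0 c => exact ⟨algebraMap ℂ _ (star c), by
    rw [AlgHom.commutes, AlgHom.commutes, Algebra.algebraMap_eq_smul_one,
      Algebra.algebraMap_eq_smul_one, star_smul, star_star, star_one]⟩
  | grade1 i => exact ⟨FreeAlgebra.ι ℂ i, by rw [ev, FreeAlgebra.lift_ι_apply]; exact hX i⟩
  | mul P Q hP hQ =>
    obtain ⟨P', hP'⟩ := hP
    obtain ⟨Q', hQ'⟩ := hQ
    exact ⟨Q' * P', by rw [map_mul, star_mul, hP', hQ', map_mul]⟩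
  | add P Q hP hQ =>
    obtain ⟨P', hP'⟩ := hP
    obtain ⟨Q', hQ'⟩ := hQ
    exact ⟨P' + Q', by rw [map_add, star_add, hP', hQ', map_add]⟩

/-- A conjugate system of self-adjoint elements is unique. -/
theorem IsConjugateSystem.unique {τ : TracialState M} {n : ℕ} {X : Fin n → M.toStarSubalgebra}
    (hX : ∀ i, IsSelfAdjoint (X i)) {ξ η : Fin n → τ.L2} (hξ : IsConjugateSystem τ X ξ)
    (hη : IsConjugateSystem τ X η) : ξ = η := by
  funext j
  have hmem : ξ j - η j ∈ τ.L2Gen X := Submodule.sub_mem _ (hξ.mem_L2Gen j) (hη.mem_L2Gen j)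
  have horth : ξ j - η j ∈ (LinearMap.range (τ.toL2 ∘ₗ (ev X).toLinearMap))ᗮ := by
    rw [Submodule.mem_orthogonal]
    rintro _ ⟨P, rfl⟩
    obtain ⟨Q, hQ⟩ := ev_star X hX P
    have h := (hξ.relations Q j).symm.trans (hη.relations Q j)
    simp only [TracialState.trMul, hQ] at h
    rw [inner_sub_right, sub_eq_zero]
    exact h
  rw [← Submodule.orthogonal_closure] at horth
  have h0 : inner ℂ (ξ j - η j) (ξ j - η j) = 0 :=
    (Submodule.mem_orthogonal _ _).mp horth _ hmem
  exact sub_eq_zero.mp (inner_self_eq_zero.mp h0)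

theorem IsConjugateSystem.fisherInformation_eq {τ : TracialState M} {n : ℕ}
    {X : Fin n → M.toStarSubalgebra} (hX : ∀ i, IsSelfAdjoint (X i)) {ξ : Fin n → τ.L2}
    (hξ : IsConjugateSystem τ X ξ) :
    fisherInformation τ X = ∑ j, ENNReal.ofReal (‖ξ j‖ ^ 2) := by
  have h : ∃ ξ : Fin n → τ.L2, IsConjugateSystem τ X ξ := ⟨ξ, hξ⟩
  rw [fisherInformation, dif_pos h, h.choose_spec.unique hX hξ]

end FreeFisher

end

/-!
An element `w ≠ 0` with `P(X) w = 0` is turned into such an annihilation for polynomials of smaller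
and smaller degree. With `a = P(X)`, the projections `p` and `q` onto the kernels of `a` and `a*`
have the same trace, and `τ(p) > 0` because `p w = w`. The key claim is that the polynomials
`Rⱼ = (τ(q ·) ⊗ id)(∂ⱼ P)`, whose degree is smaller than that of `P`, satisfy `Rⱼ(X) w = 0` again
(`exists_functional_ev_sliceLeft_mul_eq_zero`). By induction all `Rⱼ` vanish. As `τ(q) ≠ 0`, the top
degree part of `P` can be read off from the `Rⱼ`, so `P` is constant
(`DegreeLT.of_sliceLeft_eq_zero`), and a constant annihilating `w` is zero.

For the key claim, the Leibniz rule for `∂ⱼ(Q₁ P Q₂)` and the conjugate relation express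
`(τ ⊗ τ)((Q₁ ⊗ 1) (∂ⱼ P) (1 ⊗ Q₂))` through `τ(ξⱼ Q₁ P Q₂)` and slices of `∂ⱼ Q₁` and `∂ⱼ Q₂` by the
trace. Hence it is bounded by a multiple of `‖Q₁‖ ‖P Q₂‖₂ + ‖Q₂‖ ‖Q₁ P‖₂`
(`norm_distribution_sliceLeft_mul_le`), provided `‖(id ⊗ τ)(∂ⱼ Q)‖₂ ≤ 2 ‖ξⱼ‖₂ ‖Q‖`. The latter bound
(`norm_sliceRight_le`) comes from the vectors `T(Q) = ∂ⱼ*(1 ⊗ Q) = Q ξⱼ - (id ⊗ τ)(∂ⱼ Q)`: by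
coassociativity of `∂ⱼ` one has `⟨T(Q), T(Q)⟩ = ⟨ξⱼ, T(Q* Q)⟩`. Iterating the resulting inequality
`‖T(Q)‖² ≤ ‖ξⱼ‖ ‖T(Q* Q)‖`, and using that `‖T(R ^ m)‖` is at most linear in `m` times `‖R‖ ^ m`, gives
`‖T(Q)‖ ≤ ‖ξⱼ‖ ‖Q‖`.

The projections `p` and `q` themselves are not constructed. They are replaced by Cesàro means of the
powers of the contractions `1 - a* a / C` and `1 - a a* / C`. These are polynomials in `X` of norm at
most `1`, so no density theorem is needed to approximate by polynomials; the equality of the traces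
of the projections becomes `τ(f(a* a)) = τ(f(a a*))` for polynomials `f`; and `τ(q ·)` becomes a limit
along an ultrafilter.
-/

noncomputable section

namespace FreeFisher

/-! ### Slices of the non-commutative derivatives -/

variable {n : ℕ}

/-- The slice `φ ⊗ id` of a tensor. -/
def tensorSliceLeft (φ : NCPoly n →ₗ[ℂ] ℂ) : NCPoly n ⊗[ℂ] NCPoly n →ₗ[ℂ] NCPoly n :=
  (TensorProduct.lid ℂ (NCPoly n)).toLinearMap ∘ₗ TensorProduct.map φ LinearMap.id

/-- The slice `id ⊗ φ` of a tensor. -/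
def tensorSliceRight (φ : NCPoly n →ₗ[ℂ] ℂ) : NCPoly n ⊗[ℂ] NCPoly n →ₗ[ℂ] NCPoly n :=
  (TensorProduct.rid ℂ (NCPoly n)).toLinearMap ∘ₗ TensorProduct.map LinearMap.id φ

@[simp] theorem tensorSliceLeft_tmul (φ : NCPoly n →ₗ[ℂ] ℂ) (P Q : NCPoly n) :
    tensorSliceLeft φ (P ⊗ₜ[ℂ] Q) = φ P • Q := by
  simp [tensorSliceLeft]

@[simp] theorem tensorSliceRight_tmul (φ : NCPoly n →ₗ[ℂ] ℂ) (P Q : NCPoly n) :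
    tensorSliceRight φ (P ⊗ₜ[ℂ] Q) = φ Q • P := by
  simp [tensorSliceRight]

/-- The slice `(φ ⊗ id) ∘ ∂ⱼ` of the non-commutative derivative. -/
def sliceLeft (j : Fin n) (φ : NCPoly n →ₗ[ℂ] ℂ) : NCPoly n →ₗ[ℂ] NCPoly n :=
  tensorSliceLeft φ ∘ₗ ncDeriv j

/-- The slice `(id ⊗ φ) ∘ ∂ⱼ` of the non-commutative derivative. -/
def sliceRight (j : Fin n) (φ : NCPoly n →ₗ[ℂ] ℂ) : NCPoly n →ₗ[ℂ] NCPoly n :=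
  tensorSliceRight φ ∘ₗ ncDeriv j

/-- The functional `Q ↦ φ (P Q)`. -/
def mulLeftFunctional (φ : NCPoly n →ₗ[ℂ] ℂ) (P : NCPoly n) : NCPoly n →ₗ[ℂ] ℂ :=
  φ ∘ₗ LinearMap.mulLeft ℂ P

/-- The functional `P ↦ φ (P Q)`. -/
def mulRightFunctional (φ : NCPoly n →ₗ[ℂ] ℂ) (Q : NCPoly n) : NCPoly n →ₗ[ℂ] ℂ :=
  φ ∘ₗ LinearMap.mulRight ℂ Q

@[simp] theorem mulLeftFunctional_apply (φ : NCPoly n →ₗ[ℂ] ℂ) (P Q : NCPoly n) :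
    mulLeftFunctional φ P Q = φ (P * Q) := rfl

@[simp] theorem mulRightFunctional_apply (φ : NCPoly n →ₗ[ℂ] ℂ) (P Q : NCPoly n) :
    mulRightFunctional φ Q P = φ (P * Q) := rfl

theorem tensorSliceLeft_mul_right (φ : NCPoly n →ₗ[ℂ] ℂ) (z : NCPoly n ⊗[ℂ] NCPoly n)
    (Q : NCPoly n) : tensorSliceLeft φ (z * (1 ⊗ₜ[ℂ] Q)) = tensorSliceLeft φ z * Q := by
  induction z using TensorProduct.induction_on with
  | zero => simp
  | tmul a b => simp
  | add x y hx hy => simp only [add_mul, map_add, hx, hy]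

theorem tensorSliceLeft_mul_left (φ : NCPoly n →ₗ[ℂ] ℂ) (z : NCPoly n ⊗[ℂ] NCPoly n)
    (P : NCPoly n) :
    tensorSliceLeft φ ((P ⊗ₜ[ℂ] 1) * z) = tensorSliceLeft (mulLeftFunctional φ P) z := by
  induction z using TensorProduct.induction_on with
  | zero => simp
  | tmul a b => simp
  | add x y hx hy => simp only [mul_add, map_add, hx, hy]

theorem tensorSliceRight_mul_right (φ : NCPoly n →ₗ[ℂ] ℂ) (z : NCPoly n ⊗[ℂ] NCPoly n)
    (Q : NCPoly n) :
    tensorSliceRight φ (z * (1 ⊗ₜ[ℂ] Q)) = tensorSliceRight (mulRightFunctional φ Q) z := by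
  induction z using TensorProduct.induction_on with
  | zero => simp
  | tmul a b => simp
  | add x y hx hy => simp only [add_mul, map_add, hx, hy]

theorem tensorSliceRight_mul_left (φ : NCPoly n →ₗ[ℂ] ℂ) (z : NCPoly n ⊗[ℂ] NCPoly n)
    (P : NCPoly n) : tensorSliceRight φ ((P ⊗ₜ[ℂ] 1) * z) = P * tensorSliceRight φ z := by
  induction z using TensorProduct.induction_on with
  | zero => simp
  | tmul a b => simp
  | add x y hx hy => simp only [mul_add, map_add, hx, hy]

theorem sliceLeft_mul (j : Fin n) (φ : NCPoly n →ₗ[ℂ] ℂ) (P Q : NCPoly n) :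
    sliceLeft j φ (P * Q) =
      sliceLeft j φ P * Q + sliceLeft j (mulLeftFunctional φ P) Q := by
  simp [sliceLeft, ncDeriv_mul, tensorSliceLeft_mul_right, tensorSliceLeft_mul_left]

theorem sliceRight_mul (j : Fin n) (φ : NCPoly n →ₗ[ℂ] ℂ) (P Q : NCPoly n) :
    sliceRight j φ (P * Q) =
      sliceRight j (mulRightFunctional φ Q) P + P * sliceRight j φ Q := by
  simp [sliceRight, ncDeriv_mul, tensorSliceRight_mul_right, tensorSliceRight_mul_left]

theorem ncDeriv_one (j : Fin n) : ncDeriv j 1 = 0 := by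
  simp [ncDeriv]

theorem ncDeriv_algebraMap (j : Fin n) (c : ℂ) : ncDeriv j (algebraMap ℂ _ c) = 0 := by
  rw [Algebra.algebraMap_eq_smul_one, map_smul, ncDeriv_one, smul_zero]

@[simp] theorem sliceLeft_algebraMap (j : Fin n) (φ : NCPoly n →ₗ[ℂ] ℂ) (c : ℂ) :
    sliceLeft j φ (algebraMap ℂ _ c) = 0 := by
  simp [sliceLeft, ncDeriv_algebraMap]

@[simp] theorem sliceRight_algebraMap (j : Fin n) (φ : NCPoly n →ₗ[ℂ] ℂ) (c : ℂ) :
    sliceRight j φ (algebraMap ℂ _ c) = 0 := by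
  simp [sliceRight, ncDeriv_algebraMap]

@[simp] theorem sliceRight_one (j : Fin n) (φ : NCPoly n →ₗ[ℂ] ℂ) :
    sliceRight j φ 1 = 0 := by
  simp [sliceRight, ncDeriv_one]

theorem sliceLeft_ι (j : Fin n) (φ : NCPoly n →ₗ[ℂ] ℂ) (i : Fin n) :
    sliceLeft j φ (FreeAlgebra.ι ℂ i) = if i = j then algebraMap ℂ _ (φ 1) else 0 := by
  rw [sliceLeft, LinearMap.comp_apply, ncDeriv_ι]
  split_ifs
  · simp [Algebra.TensorProduct.one_def, Algebra.algebraMap_eq_smul_one]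
  · simp

theorem sliceRight_ι (j : Fin n) (φ : NCPoly n →ₗ[ℂ] ℂ) (i : Fin n) :
    sliceRight j φ (FreeAlgebra.ι ℂ i) = if i = j then algebraMap ℂ _ (φ 1) else 0 := by
  rw [sliceRight, LinearMap.comp_apply, ncDeriv_ι]
  split_ifs
  · simp [Algebra.TensorProduct.one_def, Algebra.algebraMap_eq_smul_one]
  · simp

theorem apply_sliceLeft (j : Fin n) (φ ψ : NCPoly n →ₗ[ℂ] ℂ) (P : NCPoly n) :
    ψ (sliceLeft j φ P) = φ (sliceRight j ψ P) := by
  simp only [sliceLeft, sliceRight, LinearMap.comp_apply]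
  induction ncDeriv j P using TensorProduct.induction_on with
  | zero => simp
  | tmul a b => simp [mul_comm]
  | add x y hx hy => simp only [map_add, hx, hy]

/-- The coassociativity `(id ⊗ ∂ⱼ) ∘ ∂ⱼ = (∂ⱼ ⊗ id) ∘ ∂ⱼ`, sliced in the two outer legs. -/
theorem sliceRight_sliceLeft (j : Fin n) (φ ψ : NCPoly n →ₗ[ℂ] ℂ) (P : NCPoly n) :
    sliceRight j ψ (sliceLeft j φ P) = sliceLeft j φ (sliceRight j ψ P) := by
  induction P using FreeAlgebra.induction generalizing φ ψ with
  | grade0 c => simp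
  | grade1 i => rw [sliceLeft_ι, sliceRight_ι]; split_ifs <;> simp
  | mul P Q hP hQ =>
    simp only [sliceLeft_mul, sliceRight_mul, map_add, hP, hQ]
    abel
  | add P Q hP hQ => simp only [map_add, hP, hQ]

/-! ### The adjoint of a non-commutative polynomial -/

/-- `ℂ⟨Z⟩ᵐᵒᵖ` as an algebra over `ℂ` acting through complex conjugation. -/
@[reducible] def conjOpAlgebra (n : ℕ) : Algebra ℂ (NCPoly n)ᵐᵒᵖ :=
  ((algebraMap ℂ (NCPoly n)ᵐᵒᵖ).comp (starRingEnd ℂ)).toAlgebra' fun c x =>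
    Algebra.commutes (starRingEnd ℂ c) x

/-- The conjugate-linear anti-automorphism of `ℂ⟨Z⟩` fixing every `Zᵢ`. (The `star` of Mathlib on
the free algebra is linear over the scalars instead.) -/
def ncStar : NCPoly n →+ NCPoly n :=
  (MulOpposite.opAddEquiv.symm : (NCPoly n)ᵐᵒᵖ ≃+ NCPoly n).toAddMonoidHom.comp
    (letI := conjOpAlgebra n
    (FreeAlgebra.lift ℂ fun i => MulOpposite.op (FreeAlgebra.ι ℂ i) :
      NCPoly n →ₐ[ℂ] (NCPoly n)ᵐᵒᵖ) : NCPoly n →+* (NCPoly n)ᵐᵒᵖ).toAddMonoidHom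

@[simp] theorem ncStar_mul (P Q : NCPoly n) : ncStar (P * Q) = ncStar Q * ncStar P := by
  simp [ncStar]

@[simp] theorem ncStar_ι (i : Fin n) :
    ncStar (FreeAlgebra.ι ℂ i : NCPoly n) = FreeAlgebra.ι ℂ i := by
  let := conjOpAlgebra n
  change MulOpposite.unop (FreeAlgebra.lift ℂ _ (FreeAlgebra.ι ℂ i)) = _
  rw [FreeAlgebra.lift_ι_apply, MulOpposite.unop_op]

@[simp] theorem ncStar_algebraMap (c : ℂ) :
    ncStar (algebraMap ℂ (NCPoly n) c) = algebraMap ℂ (NCPoly n) (star c) := by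
  let := conjOpAlgebra n
  change MulOpposite.unop (FreeAlgebra.lift ℂ _ (algebraMap ℂ (NCPoly n) c)) = _
  rw [AlgHom.commutes]
  rfl

@[simp] theorem ncStar_one : ncStar (1 : NCPoly n) = 1 := by
  simpa using ncStar_algebraMap (n := n) 1

@[simp] theorem ncStar_ncStar (P : NCPoly n) : ncStar (ncStar P) = P := by
  induction P using FreeAlgebra.induction with
  | grade0 c => simp
  | grade1 i => simp
  | mul P Q hP hQ => simp [hP, hQ]
  | add P Q hP hQ => simp [hP, hQ]

/-- If `φ(P*)` is the conjugate of `ψ(P)`, then the left slice by `φ` and the right slice by `ψ`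
are exchanged by the adjoint: `∂ⱼ(P*)` is the flipped adjoint of `∂ⱼ P`. -/
theorem sliceLeft_ncStar (j : Fin n) (φ ψ : NCPoly n →ₗ[ℂ] ℂ)
    (h : ∀ P, φ (ncStar P) = star (ψ P)) (P : NCPoly n) :
    sliceLeft j φ (ncStar P) = ncStar (sliceRight j ψ P) := by
  induction P using FreeAlgebra.induction generalizing φ ψ with
  | grade0 c => simp
  | grade1 i =>
    have h1 := h 1
    rw [ncStar_one] at h1
    rw [ncStar_ι, sliceLeft_ι, sliceRight_ι]
    split_ifs
    · rw [h1, ncStar_algebraMap]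
    · simp
  | mul P Q hP hQ =>
    have h' : ∀ R, mulLeftFunctional φ (ncStar Q) (ncStar R) =
        star (mulRightFunctional ψ Q R) := fun R => by
      rw [mulLeftFunctional_apply, ← ncStar_mul, h, mulRightFunctional_apply]
    rw [ncStar_mul, sliceLeft_mul, sliceRight_mul, map_add, ncStar_mul, hQ φ ψ h, hP _ _ h',
      add_comm]
  | add P Q hP hQ => simp only [map_add, hP φ ψ h, hQ φ ψ h]

/-! ### The degree filtration -/

/-- `P` has degree less than `d` (and is `0` for `d = 0`). For `d + 1` this is encoded by the
expansion `P = c + ∑ᵢ Zᵢ Pᵢ` with all `Pᵢ` of degree less than `d`. -/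
def DegreeLT : ℕ → NCPoly n → Prop
  | 0, P => P = 0
  | d + 1, P => ∃ (c : ℂ) (R : Fin n → NCPoly n), (∀ i, DegreeLT d (R i)) ∧
      P = algebraMap ℂ _ c + ∑ i, FreeAlgebra.ι ℂ i * R i

theorem DegreeLT.zero : ∀ d : ℕ, DegreeLT d (0 : NCPoly n)
  | 0 => rfl
  | d + 1 => ⟨0, 0, fun _ => DegreeLT.zero d, by simp⟩

theorem DegreeLT.add {d : ℕ} {P Q : NCPoly n} (hP : DegreeLT d P) (hQ : DegreeLT d Q) :
    DegreeLT d (P + Q) := by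
  induction d generalizing P Q with
  | zero =>
    rw [DegreeLT] at *
    rw [hP, hQ, add_zero]
  | succ d ih =>
    obtain ⟨c, R, hR, rfl⟩ := hP
    obtain ⟨c', R', hR', rfl⟩ := hQ
    refine ⟨c + c', R + R', fun i => ih (hR i) (hR' i), ?_⟩
    simp only [map_add, Pi.add_apply, mul_add, Finset.sum_add_distrib]
    abel

theorem DegreeLT.smul {d : ℕ} {P : NCPoly n} (a : ℂ) (hP : DegreeLT d P) :
    DegreeLT d (a • P) := by
  induction d generalizing P with
  | zero =>
    rw [DegreeLT] at *
    rw [hP, smul_zero]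
  | succ d ih =>
    obtain ⟨c, R, hR, rfl⟩ := hP
    refine ⟨a * c, a • R, fun i => ih (hR i), ?_⟩
    simp [smul_add, Finset.smul_sum, Algebra.smul_def a (algebraMap ℂ (NCPoly n) c)]

theorem DegreeLT.sum {ι : Type*} {d : ℕ} {s : Finset ι} {P : ι → NCPoly n}
    (h : ∀ i ∈ s, DegreeLT d (P i)) : DegreeLT d (∑ i ∈ s, P i) :=
  Finset.sum_induction P (DegreeLT d) (fun _ _ => DegreeLT.add) (DegreeLT.zero d) h

theorem DegreeLT.succ {d : ℕ} {P : NCPoly n} (hP : DegreeLT d P) : DegreeLT (d + 1) P := by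
  induction d generalizing P with
  | zero =>
    rw [DegreeLT] at hP
    rw [hP]
    exact DegreeLT.zero 1
  | succ d ih =>
    obtain ⟨c, R, hR, rfl⟩ := hP
    exact ⟨c, R, fun i => ih (hR i), rfl⟩

theorem DegreeLT.mono {d e : ℕ} (h : d ≤ e) {P : NCPoly n} (hP : DegreeLT d P) :
    DegreeLT e P := by
  induction h with
  | refl => exact hP
  | step _ ih => exact ih.succ

theorem exists_degreeLT_mul (P : NCPoly n) :
    ∀ Q : NCPoly n, (∃ d, DegreeLT d Q) → ∃ d, DegreeLT d (P * Q) := by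
  induction P using FreeAlgebra.induction with
  | grade0 c =>
    rintro Q ⟨d, hQ⟩
    exact ⟨d, by rw [← Algebra.smul_def]; exact hQ.smul c⟩
  | grade1 i =>
    rintro Q ⟨d, hQ⟩
    refine ⟨d + 1, 0, Pi.single i Q, fun k => ?_, ?_⟩
    · by_cases hk : k = i
      · subst hk; simpa using hQ
      · simpa [hk] using DegreeLT.zero d
    · rw [map_zero, zero_add, Finset.sum_eq_single i]
      · simp
      · intro k _ hk; simp [hk]
      · simp
  | mul P P' hP hP' =>
    intro Q hQ
    rw [mul_assoc]
    exact hP _ (hP' _ hQ)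
  | add P P' hP hP' =>
    intro Q hQ
    obtain ⟨d, hd⟩ := hP Q hQ
    obtain ⟨e, he⟩ := hP' Q hQ
    rw [add_mul]
    exact ⟨max d e, (hd.mono (le_max_left _ _)).add (he.mono (le_max_right _ _))⟩

theorem exists_degreeLT (P : NCPoly n) : ∃ d, DegreeLT d P := by
  have h := exists_degreeLT_mul P 1
    ⟨1, 1, 0, fun _ => DegreeLT.zero 0, by simp⟩
  rwa [mul_one] at h

theorem sliceLeft_expansion (j : Fin n) (φ : NCPoly n →ₗ[ℂ] ℂ) (c : ℂ) (R : Fin n → NCPoly n) :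
    sliceLeft j φ (algebraMap ℂ _ c + ∑ i, FreeAlgebra.ι ℂ i * R i) =
      φ 1 • R j + ∑ i, sliceLeft j (mulLeftFunctional φ (FreeAlgebra.ι ℂ i)) (R i) := by
  simp only [map_add, map_sum, sliceLeft_algebraMap, zero_add, sliceLeft_mul, sliceLeft_ι,
    Finset.sum_add_distrib, ite_mul, zero_mul, Finset.sum_ite_eq', Finset.mem_univ, if_true,
    ← Algebra.smul_def]

theorem DegreeLT.sliceLeft {d : ℕ} {P : NCPoly n} (hP : DegreeLT (d + 1) P) (j : Fin n)
    (φ : NCPoly n →ₗ[ℂ] ℂ) : DegreeLT d (sliceLeft j φ P) := by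
  induction d generalizing P φ with
  | zero =>
    obtain ⟨c, R, hR, rfl⟩ := hP
    have h0 : ∀ i, R i = 0 := hR
    simp [DegreeLT, h0]
  | succ d ih =>
    obtain ⟨c, R, hR, rfl⟩ := hP
    rw [sliceLeft_expansion]
    exact ((hR j).smul _).add (DegreeLT.sum fun i _ => (ih (hR i) _).succ)

/-- A slice by a functional with `φ 1 ≠ 0` sees the leading part: if all slices of `P` vanish, the
degree bound of `P` can be lowered until `P` is constant. -/
theorem DegreeLT.of_sliceLeft_eq_zero {d : ℕ} {P : NCPoly n} (hP : DegreeLT (d + 2) P)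
    {φ : NCPoly n →ₗ[ℂ] ℂ} (hφ : φ 1 ≠ 0) (h : ∀ j, FreeFisher.sliceLeft j φ P = 0) :
    DegreeLT (d + 1) P := by
  obtain ⟨c, R, hR, rfl⟩ := hP
  refine ⟨c, R, fun j => ?_, rfl⟩
  have hj := h j
  rw [sliceLeft_expansion, add_eq_zero_iff_eq_neg, ← Finset.sum_neg_distrib] at hj
  have : R j = (φ 1)⁻¹ • ∑ i, (-1 : ℂ) •
      FreeFisher.sliceLeft j (mulLeftFunctional φ (FreeAlgebra.ι ℂ i)) (R i) := by
    simp only [neg_smul, one_smul, ← hj, smul_smul, inv_mul_cancel₀ hφ]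
  rw [this]
  exact (DegreeLT.sum fun i _ => ((hR i).sliceLeft j _).smul _).smul _

/-! ### Left multiplication on `L²(M, τ)` -/

variable {H : Type*} [NormedAddCommGroup H] [InnerProductSpace ℂ H] [CompleteSpace H]
  {M : VonNeumannAlgebra H}

theorem isClosed_coe_vonNeumannAlgebra (M : VonNeumannAlgebra H) :
    IsClosed (M.toStarSubalgebra : Set (H →L[ℂ] H)) := by
  have h : (M.toStarSubalgebra : Set (H →L[ℂ] H)) = _ := M.centralizer_centralizer.symm
  rw [h]
  exact Set.isClosed_centralizer _

theorem exists_star_mul_self_eq_norm_sq_sub {A : Type*} [CStarAlgebra A] (x : A) :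
    ∃ z : A, ((‖x‖ ^ 2 : ℝ) : ℂ) • 1 - star x * x = star z * z := by
  let : PartialOrder A := CStarAlgebra.spectralOrder A
  have : StarOrderedRing A := CStarAlgebra.spectralOrderedRing A
  have h := (IsSelfAdjoint.star_mul_self x).le_algebraMap_norm_self
  rw [← sub_nonneg, CStarAlgebra.nonneg_iff_eq_star_mul_self] at h
  obtain ⟨z, hz⟩ := h
  refine ⟨z, ?_⟩
  rw [← hz, CStarRing.norm_star_mul_self, Algebra.algebraMap_eq_smul_one, sq, Complex.coe_smul]

namespace TracialState

variable (τ : TracialState M)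

/-- The inner product of `L²(M, τ)` in the form in which the general lemmas about inner product
spaces apply to it. (By default, instance search reaches the inner product of the dense subspace
through its structure of a `C*`-module over `ℂ`.) -/
@[reducible] def l2Inner : Inner ℂ τ.L2 := InnerProductSpace.toInner

attribute [local instance] l2Inner

theorem inner_toL2_eq (x y : M.toStarSubalgebra) :
    inner ℂ (τ.toL2 x) (τ.toL2 y) = τ.toLinearMap (star x * y) :=
  τ.inner_toL2 x y

theorem norm_toL2_sq (x : M.toStarSubalgebra) :
    ‖τ.toL2 x‖ ^ 2 = (τ.toLinearMap (star x * x)).re := by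
  rw [← inner_toL2_eq, ← inner_self_eq_norm_sq (𝕜 := ℂ)]
  rfl

theorem norm_toL2_star (x : M.toStarSubalgebra) : ‖τ.toL2 (star x)‖ = ‖τ.toL2 x‖ := by
  rw [← sq_eq_sq₀ (norm_nonneg _) (norm_nonneg _), norm_toL2_sq, norm_toL2_sq, star_star,
    τ.tracial]

theorem norm_toL2_one : ‖τ.toL2 1‖ = 1 := by
  rw [← sq_eq_sq₀ (norm_nonneg _) zero_le_one, norm_toL2_sq, star_one, one_mul, τ.map_one]
  simp

theorem norm_toL2_mul_le (x y : M.toStarSubalgebra) :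
    ‖τ.toL2 (x * y)‖ ≤ ‖x‖ * ‖τ.toL2 y‖ := by
  rw [← sq_le_sq₀ (norm_nonneg _) (by positivity), mul_pow, norm_toL2_sq, norm_toL2_sq]
  have := isClosed_coe_vonNeumannAlgebra M
  obtain ⟨z, hz⟩ := exists_star_mul_self_eq_norm_sq_sub x
  have h := (Complex.nonneg_iff.mp (τ.nonneg (z * y))).1
  have e : star (z * y) * (z * y) =
      ((‖x‖ ^ 2 : ℝ) : ℂ) • (star y * y) - star (x * y) * (x * y) := by
    rw [star_mul, star_mul, mul_assoc, ← mul_assoc (star z), ← hz, sub_mul, mul_sub,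
      smul_mul_assoc, one_mul, mul_smul_comm]
    noncomm_ring
  rw [e, map_sub, map_smul, Complex.sub_re, smul_eq_mul, Complex.re_ofReal_mul] at h
  linarith

theorem norm_toL2_le (x : M.toStarSubalgebra) : ‖τ.toL2 x‖ ≤ ‖x‖ := by
  simpa [norm_toL2_one] using τ.norm_toL2_mul_le x 1

theorem norm_toL2_mul_le' (x y : M.toStarSubalgebra) :
    ‖τ.toL2 (x * y)‖ ≤ ‖τ.toL2 x‖ * ‖y‖ := by
  rw [← norm_toL2_star, star_mul, mul_comm, ← norm_toL2_star τ x, ← norm_star y]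
  exact τ.norm_toL2_mul_le _ _

theorem norm_apply_mul_le (x y : M.toStarSubalgebra) :
    ‖τ.toLinearMap (x * y)‖ ≤ ‖τ.toL2 x‖ * ‖τ.toL2 y‖ := by
  have h := norm_inner_le_norm (𝕜 := ℂ) (τ.toL2 (star x)) (τ.toL2 y)
  rwa [inner_toL2_eq, star_star, norm_toL2_star] at h

theorem norm_apply_le (x : M.toStarSubalgebra) : ‖τ.toLinearMap x‖ ≤ ‖x‖ := by
  have h := τ.norm_apply_mul_le x 1
  rw [mul_one, norm_toL2_one, mul_one] at h
  exact h.trans (τ.norm_toL2_le x)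

theorem toL2_eq_zero {x : M.toStarSubalgebra} (h : τ.toL2 x = 0) : x = 0 := by
  apply τ.faithful
  rw [← inner_toL2_eq, h, inner_zero_left]

/-- Left multiplication by `x ∈ M` on the dense subspace `M` of `L²(M, τ)`. -/
def preLeftMul (x : M.toStarSubalgebra) : τ.PreL2 →L[ℂ] τ.PreL2 :=
  LinearMap.mkContinuous (LinearMap.mulLeft ℂ x : M.toStarSubalgebra →ₗ[ℂ] M.toStarSubalgebra) ‖x‖
    fun y => by
      have h := τ.norm_toL2_mul_le x y
      exact (UniformSpace.Completion.norm_coe (E := τ.PreL2) _).symm.le.trans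
        (h.trans (mul_le_mul_of_nonneg_left
          (UniformSpace.Completion.norm_coe (E := τ.PreL2) y).le (norm_nonneg x)))

/-- Left multiplication by `x ∈ M` on `L²(M, τ)`. -/
def leftMul (x : M.toStarSubalgebra) : τ.L2 →L[ℂ] τ.L2 :=
  (τ.preLeftMul x).completion

theorem leftMul_toL2 (x y : M.toStarSubalgebra) : τ.leftMul x (τ.toL2 y) = τ.toL2 (x * y) :=
  ContinuousLinearMap.completion_apply_coe (τ.preLeftMul x) (show τ.PreL2 from y)

theorem denseRange_toL2 : DenseRange τ.toL2 :=
  UniformSpace.Completion.denseRange_coe (α := τ.PreL2)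

theorem norm_leftMul_le (x : M.toStarSubalgebra) (η : τ.L2) : ‖τ.leftMul x η‖ ≤ ‖x‖ * ‖η‖ := by
  induction η using τ.denseRange_toL2.induction_on with
  | hp => exact isClosed_le (by fun_prop) (by fun_prop)
  | ih y => rw [leftMul_toL2]; exact τ.norm_toL2_mul_le x y

theorem leftMul_mul (x y : M.toStarSubalgebra) (η : τ.L2) :
    τ.leftMul (x * y) η = τ.leftMul x (τ.leftMul y η) := by
  induction η using τ.denseRange_toL2.induction_on with
  | hp => exact isClosed_eq (by fun_prop) (by fun_prop)
  | ih z => simp only [leftMul_toL2, mul_assoc]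

theorem leftMul_one (η : τ.L2) : τ.leftMul 1 η = η := by
  induction η using τ.denseRange_toL2.induction_on with
  | hp => exact isClosed_eq (by fun_prop) (by fun_prop)
  | ih z => simp only [leftMul_toL2, one_mul]

theorem inner_leftMul (x : M.toStarSubalgebra) (η ζ : τ.L2) :
    inner ℂ η (τ.leftMul x ζ) = inner ℂ (τ.leftMul (star x) η) ζ := by
  induction η using τ.denseRange_toL2.induction_on with
  | hp => exact isClosed_eq (by fun_prop) (by fun_prop)
  | ih y =>
    induction ζ using τ.denseRange_toL2.induction_on with
    | hp => exact isClosed_eq (by fun_prop) (by fun_prop)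
    | ih z => simp only [leftMul_toL2, inner_toL2_eq, star_mul, star_star, mul_assoc]

end TracialState

/-! ### Bounds for the slices by the trace -/

attribute [local instance] TracialState.l2Inner

theorem ev_ncStar {X : Fin n → M.toStarSubalgebra} (hX : ∀ i, IsSelfAdjoint (X i))
    (P : NCPoly n) : ev X (ncStar P) = star (ev X P) := by
  induction P using FreeAlgebra.induction with
  | grade0 c =>
    rw [ncStar_algebraMap, AlgHom.commutes, AlgHom.commutes, Algebra.algebraMap_eq_smul_one,
      Algebra.algebraMap_eq_smul_one, star_smul, star_one]
  | grade1 i => rw [ncStar_ι, ev, FreeAlgebra.lift_ι_apply]; exact (hX i).symm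
  | mul P Q hP hQ => rw [ncStar_mul, map_mul, map_mul, star_mul, hP, hQ]
  | add P Q hP hQ => rw [map_add, map_add, map_add, star_add, hP, hQ]

theorem norm_one_le (M : VonNeumannAlgebra H) : ‖(1 : M.toStarSubalgebra)‖ ≤ 1 :=
  ContinuousLinearMap.norm_id_le

theorem norm_pow_le_of_le {x : M.toStarSubalgebra} {r : ℝ} (hx : ‖x‖ ≤ r) (m : ℕ) :
    ‖x ^ m‖ ≤ r ^ m := by
  induction m with
  | zero => simpa using norm_one_le M
  | succ m ih =>
    rw [pow_succ, pow_succ]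
    exact (norm_mul_le _ _).trans
      (mul_le_mul ih hx (norm_nonneg _) (pow_nonneg ((norm_nonneg _).trans hx) m))

namespace TracialState

/-- The distribution of `X` with respect to `τ`: the functional `P ↦ τ(P(X))`. -/
def distribution (τ : TracialState M) (X : Fin n → M.toStarSubalgebra) : NCPoly n →ₗ[ℂ] ℂ :=
  τ.toLinearMap ∘ₗ (ev X).toLinearMap

theorem distribution_apply (τ : TracialState M) (X : Fin n → M.toStarSubalgebra) (P : NCPoly n) :
    τ.distribution X P = τ.toLinearMap (ev X P) := rfl

theorem distribution_ncStar (τ : TracialState M) {X : Fin n → M.toStarSubalgebra}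
    (hX : ∀ i, IsSelfAdjoint (X i)) (P : NCPoly n) :
    τ.distribution X (ncStar P) = star (τ.distribution X P) := by
  rw [distribution_apply, ev_ncStar hX, τ.map_star, distribution_apply]

theorem norm_distribution_mul_le (τ : TracialState M) (X : Fin n → M.toStarSubalgebra)
    (P Q : NCPoly n) :
    ‖τ.distribution X (P * Q)‖ ≤ ‖τ.toL2 (ev X P)‖ * ‖τ.toL2 (ev X Q)‖ := by
  rw [distribution_apply, map_mul]
  exact τ.norm_apply_mul_le _ _

theorem tensor_ncDeriv (τ : TracialState M) (X : Fin n → M.toStarSubalgebra) (j : Fin n)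
    (P : NCPoly n) :
    τ.tensor (Algebra.TensorProduct.map (ev X) (ev X) (ncDeriv j P)) =
      τ.distribution X (sliceLeft j (τ.distribution X) P) := by
  rw [sliceLeft, LinearMap.comp_apply]
  induction ncDeriv j P using TensorProduct.induction_on with
  | zero => simp
  | tmul a b => simp [tensor, distribution_apply]
  | add x y hx hy => simp only [map_add, hx, hy]

/-- `ξ` is a `j`-th conjugate variable of `X`, with the left side of the conjugate relation written
through a slice. -/
def IsConjugateVariable (τ : TracialState M) (X : Fin n → M.toStarSubalgebra) (j : Fin n)
    (ξ : τ.L2) : Prop :=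
  ∀ P : NCPoly n, τ.distribution X (sliceLeft j (τ.distribution X) P) =
    inner ℂ (τ.toL2 (star (ev X P))) ξ

/-- The vector `∂ⱼ*(1 ⊗ R) = R ξ - (id ⊗ τ)(∂ⱼ R)`, where `∂ⱼ*` is the adjoint of `∂ⱼ` as an
unbounded operator and `ξ` a conjugate variable; see `inner_adjointDeriv`. -/
def adjointDeriv (τ : TracialState M) (X : Fin n → M.toStarSubalgebra) (j : Fin n)
    (ξ : τ.L2) (R : NCPoly n) : τ.L2 :=
  τ.leftMul (ev X R) ξ - τ.toL2 (ev X (sliceRight j (τ.distribution X) R))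

variable {τ : TracialState M} {X : Fin n → M.toStarSubalgebra} {j : Fin n} {ξ : τ.L2}

theorem inner_adjointDeriv (hξ : τ.IsConjugateVariable X j ξ) (P R : NCPoly n) :
    inner ℂ (τ.toL2 (star (ev X P))) (τ.adjointDeriv X j ξ R) =
      τ.distribution X (sliceLeft j (τ.distribution X) P * R) := by
  have h := hξ (P * R)
  rw [sliceLeft_mul, map_add, apply_sliceLeft, map_mul (ev X), star_mul] at h
  rw [adjointDeriv, inner_sub_right, inner_leftMul, leftMul_toL2, ← h, inner_toL2_eq, star_star,
    mulLeftFunctional_apply, distribution_apply τ X (P * _), map_mul (ev X), add_sub_cancel_right]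

theorem inner_conjugateVariable (hX : ∀ i, IsSelfAdjoint (X i))
    (hξ : τ.IsConjugateVariable X j ξ) (P : NCPoly n) :
    inner ℂ ξ (τ.toL2 (ev X P)) =
      τ.distribution X (sliceRight j (τ.distribution X) P) := by
  have h := hξ (ncStar P)
  rw [sliceLeft_ncStar j _ _ (τ.distribution_ncStar hX), distribution_ncStar τ hX, ev_ncStar hX,
    star_star] at h
  rw [← inner_conj_symm, ← h]
  exact star_star _

/-- The inner product of `∂ⱼ*(1 ⊗ Q)` and `∂ⱼ*(1 ⊗ R)` depends only on `Q* R`. This is where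
coassociativity of `∂ⱼ` enters. -/
theorem inner_adjointDeriv_adjointDeriv (hX : ∀ i, IsSelfAdjoint (X i))
    (hξ : τ.IsConjugateVariable X j ξ) (Q R : NCPoly n) :
    inner ℂ (τ.adjointDeriv X j ξ Q) (τ.adjointDeriv X j ξ R) =
      inner ℂ ξ (τ.adjointDeriv X j ξ (ncStar Q * R)) := by
  have h1 : inner ℂ (τ.toL2 (ev X (sliceRight j (τ.distribution X) Q)))
      (τ.adjointDeriv X j ξ R) = inner ℂ ξ (τ.toL2 (ev X
        (sliceRight j (mulRightFunctional (τ.distribution X) R) (ncStar Q)))) := by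
    rw [inner_conjugateVariable hX hξ, ← apply_sliceLeft, ← sliceRight_sliceLeft,
      ← apply_sliceLeft, mulRightFunctional_apply, ← inner_adjointDeriv hξ,
      sliceLeft_ncStar j _ _ (τ.distribution_ncStar hX), ev_ncStar hX, star_star]
  have h2 : inner ℂ (τ.leftMul (ev X Q) ξ) (τ.adjointDeriv X j ξ R) =
      inner ℂ ξ (τ.leftMul (ev X (ncStar Q)) (τ.adjointDeriv X j ξ R)) := by
    rw [inner_leftMul, ev_ncStar hX, star_star]
  have h3 : τ.adjointDeriv X j ξ (ncStar Q * R) =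
      τ.leftMul (ev X (ncStar Q)) (τ.adjointDeriv X j ξ R) - τ.toL2 (ev X
        (sliceRight j (mulRightFunctional (τ.distribution X) R) (ncStar Q))) := by
    simp only [adjointDeriv, sliceRight_mul, map_mul, map_add, map_sub, leftMul_mul, leftMul_toL2]
    abel
  rw [h3, inner_sub_right, ← h1, ← h2, ← inner_sub_left]
  rfl

theorem norm_adjointDeriv_sq_le (hX : ∀ i, IsSelfAdjoint (X i))
    (hξ : τ.IsConjugateVariable X j ξ) (Q : NCPoly n) :
    ‖τ.adjointDeriv X j ξ Q‖ ^ 2 ≤ ‖ξ‖ * ‖τ.adjointDeriv X j ξ (ncStar Q * Q)‖ := by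
  have h := norm_inner_le_norm (𝕜 := ℂ) ξ (τ.adjointDeriv X j ξ (ncStar Q * Q))
  rwa [← inner_adjointDeriv_adjointDeriv hX hξ, inner_self_eq_norm_sq_to_K, norm_pow,
    RCLike.norm_ofReal, abs_norm] at h

theorem exists_norm_tensorSliceRight_le (τ : TracialState M) (X : Fin n → M.toStarSubalgebra)
    (z : NCPoly n ⊗[ℂ] NCPoly n) : ∃ K : ℝ, 0 ≤ K ∧ ∀ S : NCPoly n,
      ‖τ.toL2 (ev X (tensorSliceRight (mulRightFunctional (τ.distribution X) S) z))‖ ≤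
        K * ‖ev X S‖ := by
  induction z using TensorProduct.induction_on with
  | zero => exact ⟨0, le_rfl, fun S => by simp⟩
  | tmul a b =>
    refine ⟨‖ev X b‖ * ‖τ.toL2 (ev X a)‖, by positivity, fun S => ?_⟩
    rw [tensorSliceRight_tmul, map_smul, map_smul, norm_smul, mulRightFunctional_apply,
      distribution_apply, map_mul]
    calc _ ≤ (‖ev X b‖ * ‖ev X S‖) * ‖τ.toL2 (ev X a)‖ :=
          mul_le_mul_of_nonneg_right ((τ.norm_apply_le _).trans (norm_mul_le _ _)) (norm_nonneg _)
      _ = _ := by ring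
  | add x y hx hy =>
    obtain ⟨K, hK, h⟩ := hx
    obtain ⟨L, hL, h'⟩ := hy
    refine ⟨K + L, add_nonneg hK hL, fun S => ?_⟩
    rw [map_add, map_add, map_add, add_mul]
    exact (norm_add_le _ _).trans (add_le_add (h S) (h' S))

/-- The slices of powers grow at most like a linear factor times the expected exponential rate,
because `∂ⱼ` is a derivation. -/
theorem exists_norm_sliceRight_pow_le (τ : TracialState M) (X : Fin n → M.toStarSubalgebra)
    (j : Fin n) (R : NCPoly n) {r : ℝ} (hr : 0 < r) (hR : ‖ev X R‖ ≤ r) :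
    ∃ B : ℝ, 0 ≤ B ∧ ∀ m : ℕ,
      ‖τ.toL2 (ev X (sliceRight j (τ.distribution X) (R ^ m)))‖ ≤ B * m * r ^ m := by
  obtain ⟨K, hK, hS⟩ := exists_norm_tensorSliceRight_le τ X (ncDeriv j R)
  refine ⟨K / r, by positivity, fun m => ?_⟩
  induction m with
  | zero => simp
  | succ m ih =>
    rw [pow_succ', sliceRight_mul, map_add, map_add, map_mul]
    have h1 := (hS (R ^ m)).trans (mul_le_mul_of_nonneg_left
      (map_pow (ev X) R m ▸ norm_pow_le_of_le hR m : ‖ev X (R ^ m)‖ ≤ r ^ m) hK)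
    have h2 := (τ.norm_toL2_mul_le (ev X R)
      (ev X (sliceRight j (τ.distribution X) (R ^ m)))).trans
      (mul_le_mul hR ih (norm_nonneg _) hr.le)
    refine ((norm_add_le _ _).trans (add_le_add h1 h2)).trans (le_of_eq ?_)
    push_cast
    field_simp
    ring

end TracialState

/-- If `g k ^ 2 ≤ c g (k + 1)` and `g k` is bounded by `r ^ (2 ^ k)` up to a factor linear in
`2 ^ k`, then `g 0 ≤ c r`: otherwise `g k` would grow like a larger exponential of `2 ^ k`. -/
theorem le_mul_of_sq_le_mul_succ {g : ℕ → ℝ} {c B r : ℝ} (hc : 0 ≤ c)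
    (hr : 0 < r) (hstep : ∀ k, g k ^ 2 ≤ c * g (k + 1))
    (hbound : ∀ k, g k ≤ (c + B * (2 ^ k : ℕ)) * r ^ 2 ^ k) : g 0 ≤ c * r := by
  rcases hc.eq_or_lt with rfl | hc
  · have h := hstep 0
    rw [zero_mul] at h
    rw [zero_mul, pow_eq_zero_iff two_ne_zero |>.mp (le_antisymm h (sq_nonneg _))]
  by_contra! hlt
  set q := g 0 / (c * r) with hq
  have hq1 : 1 < q := (one_lt_div (by positivity)).mpr hlt
  have hlow : ∀ k, c * (r * q) ^ 2 ^ k ≤ g k := by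
    intro k
    induction k with
    | zero => rw [hq, pow_zero, pow_one]; apply le_of_eq; field_simp
    | succ k ih =>
      have h0 : 0 ≤ c * (r * q) ^ 2 ^ k := by positivity
      have h1 := (pow_le_pow_left₀ h0 ih 2).trans (hstep k)
      refine le_of_mul_le_mul_left (le_trans (le_of_eq ?_) h1) hc
      rw [pow_succ 2 k, pow_mul]
      ring
  have hle : ∀ k, (1 : ℝ) ≤ (1 / q ^ (2 ^ k)) + B / c * ((2 ^ k : ℕ) / q ^ 2 ^ k) := by
    intro k
    have h := (hlow k).trans (hbound k)
    rw [mul_pow, mul_comm (r ^ _), ← mul_assoc] at h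
    have h' := le_of_mul_le_mul_right h (by positivity)
    have hqk : 0 < q ^ 2 ^ k := by positivity
    have : (1 / q ^ (2 ^ k)) + B / c * ((2 ^ k : ℕ) / q ^ 2 ^ k) =
        (c + B * (2 ^ k : ℕ)) / (c * q ^ 2 ^ k) := by
      field_simp
    rw [this, one_le_div (by positivity)]
    exact h'
  have htwo : Filter.Tendsto (fun k : ℕ => 2 ^ k) Filter.atTop Filter.atTop :=
    tendsto_pow_atTop_atTop_of_one_lt one_lt_two
  have h0 := (tendsto_pow_const_div_const_pow_of_one_lt 0 hq1).comp htwo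
  have h1 := (tendsto_pow_const_div_const_pow_of_one_lt 1 hq1).comp htwo
  have hlim := h0.add (h1.const_mul (B / c))
  rw [mul_zero, add_zero] at hlim
  refine absurd (ge_of_tendsto' hlim fun k => ?_) (not_le.mpr one_pos)
  simpa using hle k

namespace TracialState

variable {τ : TracialState M} {X : Fin n → M.toStarSubalgebra} {j : Fin n} {ξ : τ.L2}

theorem norm_adjointDeriv_le_of_ncStar_eq (hX : ∀ i, IsSelfAdjoint (X i))
    (hξ : τ.IsConjugateVariable X j ξ) {R : NCPoly n} (hR : ncStar R = R) :
    ‖τ.adjointDeriv X j ξ R‖ ≤ ‖ξ‖ * ‖ev X R‖ := by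
  have key : ∀ r : ℝ, 0 < r → ‖ev X R‖ ≤ r → ‖τ.adjointDeriv X j ξ R‖ ≤ ‖ξ‖ * r := by
    intro r hr hRr
    obtain ⟨B, hB, hpow⟩ := exists_norm_sliceRight_pow_le τ X j R hr hRr
    have hstar : ∀ m : ℕ, ncStar (R ^ m) = R ^ m := by
      intro m
      induction m with
      | zero => simp
      | succ m ih => rw [pow_succ, ncStar_mul, ih, hR, ← pow_succ, ← pow_succ']
    have h := le_mul_of_sq_le_mul_succ (g := fun k => ‖τ.adjointDeriv X j ξ (R ^ 2 ^ k)‖)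
      (c := ‖ξ‖) (B := B) (r := r) (norm_nonneg _) hr ?_ ?_
    · simpa using h
    · intro k
      have h := norm_adjointDeriv_sq_le hX hξ (R ^ 2 ^ k)
      rwa [hstar, ← pow_two, ← pow_mul, ← pow_succ] at h
    · intro k
      rw [add_mul]
      refine (norm_sub_le _ _).trans (add_le_add ?_ (hpow _))
      rw [mul_comm]
      refine (τ.norm_leftMul_le _ _).trans (mul_le_mul_of_nonneg_right ?_ (norm_nonneg _))
      rw [map_pow]
      exact norm_pow_le_of_le hRr _
  -- `key` needs `0 < r`, so `‖ev X R‖ = 0` is covered by letting `r` decrease to `‖ev X R‖`.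
  refine le_of_forall_pos_le_add fun ε hε => ?_
  have h := key (‖ev X R‖ + ε / (‖ξ‖ + 1)) (by positivity) (by
    have : 0 ≤ ε / (‖ξ‖ + 1) := by positivity
    linarith)
  refine h.trans ?_
  rw [mul_add]
  have : ‖ξ‖ * (ε / (‖ξ‖ + 1)) ≤ ε := by
    rw [← mul_div_assoc, div_le_iff₀ (by positivity)]
    nlinarith [norm_nonneg ξ]
  linarith

/-- The map `R ↦ ∂ⱼ*(1 ⊗ R)` is bounded from the operator norm to the `L²` norm. -/
theorem norm_adjointDeriv_le (hX : ∀ i, IsSelfAdjoint (X i))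
    (hξ : τ.IsConjugateVariable X j ξ) (Q : NCPoly n) :
    ‖τ.adjointDeriv X j ξ Q‖ ≤ ‖ξ‖ * ‖ev X Q‖ := by
  rw [← sq_le_sq₀ (norm_nonneg _) (by positivity)]
  have h := norm_adjointDeriv_le_of_ncStar_eq hX hξ (R := ncStar Q * Q) (by simp)
  have hn : ‖ev X (ncStar Q * Q)‖ = ‖ev X Q‖ * ‖ev X Q‖ := by
    rw [map_mul, ev_ncStar hX]
    exact CStarRing.norm_star_mul_self (x := (ev X Q : H →L[ℂ] H))
  rw [hn] at h
  refine (norm_adjointDeriv_sq_le hX hξ Q).trans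
    ((mul_le_mul_of_nonneg_left h (norm_nonneg _)).trans (le_of_eq (by ring)))

theorem norm_sliceRight_le (hX : ∀ i, IsSelfAdjoint (X i))
    (hξ : τ.IsConjugateVariable X j ξ) (Q : NCPoly n) :
    ‖τ.toL2 (ev X (sliceRight j (τ.distribution X) Q))‖ ≤ 2 * ‖ξ‖ * ‖ev X Q‖ := by
  have h1 := norm_adjointDeriv_le hX hξ Q
  have h2 := τ.norm_leftMul_le (ev X Q) ξ
  have h3 : τ.toL2 (ev X (sliceRight j (τ.distribution X) Q)) =
      τ.leftMul (ev X Q) ξ - τ.adjointDeriv X j ξ Q := by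
    rw [adjointDeriv, sub_sub_cancel]
  rw [h3]
  refine (norm_sub_le _ _).trans ?_
  linarith

theorem norm_sliceLeft_le (hX : ∀ i, IsSelfAdjoint (X i))
    (hξ : τ.IsConjugateVariable X j ξ) (Q : NCPoly n) :
    ‖τ.toL2 (ev X (sliceLeft j (τ.distribution X) Q))‖ ≤ 2 * ‖ξ‖ * ‖ev X Q‖ := by
  have h := norm_sliceRight_le hX hξ (ncStar Q)
  have e := sliceLeft_ncStar j _ _ (τ.distribution_ncStar hX) (ncStar Q)
  rw [ncStar_ncStar] at e
  rw [e, ev_ncStar hX, norm_toL2_star]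
  rwa [ev_ncStar hX, norm_star] at h

/-- `(τ ⊗ τ)((Q₁ ⊗ 1) (∂ⱼ P) (1 ⊗ Q₂))` is small if `P Q₂` and `Q₁ P` are small in the `L²` norm and
`Q₁`, `Q₂` are bounded in the operator norm. -/
theorem norm_distribution_sliceLeft_mul_le (hX : ∀ i, IsSelfAdjoint (X i))
    (hξ : τ.IsConjugateVariable X j ξ) (P Q₁ Q₂ : NCPoly n) :
    ‖τ.distribution X (sliceLeft j (mulLeftFunctional (τ.distribution X) Q₁) P * Q₂)‖ ≤
      3 * ‖ξ‖ * (‖ev X Q₁‖ * ‖τ.toL2 (ev X (P * Q₂))‖) +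
        2 * ‖ξ‖ * (‖ev X Q₂‖ * ‖τ.toL2 (ev X (Q₁ * P))‖) := by
  have h0 := hξ (Q₁ * P * Q₂)
  rw [sliceLeft_mul, sliceLeft_mul, add_mul, map_add, map_add, apply_sliceLeft,
    mulLeftFunctional_apply, mul_assoc (sliceLeft j _ Q₁)] at h0
  have h1 := norm_inner_le_norm (𝕜 := ℂ) (τ.toL2 (star (ev X (Q₁ * P * Q₂)))) ξ
  rw [norm_toL2_star] at h1
  have h1' := τ.norm_toL2_mul_le (ev X Q₁) (ev X (P * Q₂))
  have h2 := τ.norm_distribution_mul_le X (sliceLeft j (τ.distribution X) Q₁) (P * Q₂)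
  have h2' := mul_le_mul_of_nonneg_right (norm_sliceLeft_le hX hξ Q₁)
    (norm_nonneg (τ.toL2 (ev X (P * Q₂))))
  have h3 := τ.norm_distribution_mul_le X (Q₁ * P) (sliceRight j (τ.distribution X) Q₂)
  have h3' := mul_le_mul_of_nonneg_left (norm_sliceRight_le hX hξ Q₂)
    (norm_nonneg (τ.toL2 (ev X (Q₁ * P))))
  have h1'' := mul_le_mul_of_nonneg_right h1' (norm_nonneg ξ)
  rw [← map_mul, ← mul_assoc] at h1''
  have e : τ.distribution X (sliceLeft j (mulLeftFunctional (τ.distribution X) Q₁) P * Q₂) =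
      inner ℂ (τ.toL2 (star (ev X (Q₁ * P * Q₂)))) ξ -
        τ.distribution X (sliceLeft j (τ.distribution X) Q₁ * (P * Q₂)) -
        τ.distribution X (Q₁ * P * sliceRight j (τ.distribution X) Q₂) := by
    rw [← h0]; ring
  rw [e]
  refine (norm_sub_le _ _).trans ((add_le_add_left (norm_sub_le _ _) _).trans ?_)
  linarith

end TracialState

/-! ### Cesàro means approximating kernel projections -/

section Cesaro

variable {A B : Type*} [Ring A] [Algebra ℂ A] [Ring B] [Algebra ℂ B]

/-- The Cesàro mean `(1 + s + ⋯ + s ^ N) / (N + 1)`. -/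
def cesaroMean (N : ℕ) (s : A) : A :=
  ((N + 1 : ℕ) : ℂ)⁻¹ • ∑ k ∈ Finset.range (N + 1), s ^ k

theorem map_cesaroMean (f : A →ₐ[ℂ] B) (N : ℕ) (s : A) :
    f (cesaroMean N s) = cesaroMean N (f s) := by
  simp [cesaroMean]

theorem one_sub_mul_cesaroMean (N : ℕ) (s : A) :
    (1 - s) * cesaroMean N s = ((N + 1 : ℕ) : ℂ)⁻¹ • (1 - s ^ (N + 1)) := by
  rw [cesaroMean, mul_smul_comm, mul_neg_geom_sum]

theorem cesaroMean_mul_of_mul_eq (N : ℕ) {s w : A} (h : s * w = w) :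
    cesaroMean N s * w = w := by
  have hk : ∀ k : ℕ, s ^ k * w = w := by
    intro k
    induction k with
    | zero => simp
    | succ k ih => rw [pow_succ, mul_assoc, h, ih]
  rw [cesaroMean, smul_mul_assoc, Finset.sum_mul, Finset.sum_congr rfl fun k _ => hk k,
    Finset.sum_const, Finset.card_range, ← Nat.cast_smul_eq_nsmul ℂ, smul_smul,
    inv_mul_cancel₀ (Nat.cast_ne_zero.mpr N.succ_ne_zero), one_smul]

/-- The Cesàro means of the contraction `1 - a* a / C`, where `C ≥ ‖a‖²`. They approximate the
projection onto the kernel of `a`. The element `a*` is a separate argument `b` so that the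
definition also makes sense for formal polynomials. -/
def kernelMean (C : ℝ) (b a : A) (N : ℕ) : A :=
  cesaroMean N (1 - ((C⁻¹ : ℝ) : ℂ) • (b * a))

theorem map_kernelMean (f : A →ₐ[ℂ] B) (C : ℝ) (b a : A) (N : ℕ) :
    f (kernelMean C b a N) = kernelMean C (f b) (f a) N := by
  simp [kernelMean, map_cesaroMean]

theorem kernelMean_mul (C : ℝ) {b a w : A} (h : a * w = 0) (N : ℕ) :
    kernelMean C b a N * w = w := by
  refine cesaroMean_mul_of_mul_eq N ?_
  rw [sub_mul, one_mul, smul_mul_assoc, mul_assoc, h, mul_zero, smul_zero, sub_zero]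

theorem mul_kernelMean {C : ℝ} (hC : 0 < C) (b a : A) (N : ℕ) :
    b * a * kernelMean C b a N = ((C / (N + 1) : ℝ) : ℂ) •
      (1 - (1 - ((C⁻¹ : ℝ) : ℂ) • (b * a)) ^ (N + 1)) := by
  have h := one_sub_mul_cesaroMean N (1 - ((C⁻¹ : ℝ) : ℂ) • (b * a))
  rw [sub_sub_cancel, smul_mul_assoc] at h
  have hC' : (C : ℂ) ≠ 0 := Complex.ofReal_ne_zero.mpr hC.ne'
  have h2 := congrArg (fun x => (C : ℂ) • x) h
  simp only [smul_smul] at h2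
  rw [Complex.ofReal_inv, mul_inv_cancel₀ hC', one_smul] at h2
  rw [kernelMean, Complex.ofReal_inv, h2]
  push_cast
  rw [div_eq_mul_inv]

end Cesaro

section CStar

variable {A : Type*} [CStarAlgebra A]

theorem norm_one_sub_smul_star_mul_self_le {C : ℝ} (hC : 0 < C) (a : A) (ha : ‖a‖ ^ 2 ≤ C) :
    ‖1 - ((C⁻¹ : ℝ) : ℂ) • (star a * a)‖ ≤ 1 := by
  let : PartialOrder A := CStarAlgebra.spectralOrder A
  have : StarOrderedRing A := CStarAlgebra.spectralOrderedRing A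
  rw [Complex.coe_smul]
  have h0 : 0 ≤ C⁻¹ • (star a * a) := smul_nonneg (inv_nonneg.mpr hC.le) (star_mul_self_nonneg a)
  have h1 : C⁻¹ • (star a * a) ≤ 1 := by
    refine (CStarAlgebra.norm_le_one_iff_of_nonneg _ h0).mp ?_
    rw [norm_smul, CStarRing.norm_star_mul_self, Real.norm_of_nonneg (inv_nonneg.mpr hC.le),
      inv_mul_le_iff₀ hC, ← sq, mul_one]
    exact ha
  exact (CStarAlgebra.norm_le_one_iff_of_nonneg _ (sub_nonneg.mpr h1)).mpr (sub_le_self _ h0)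

end CStar

theorem norm_cesaroMean_le (N : ℕ) {s : M.toStarSubalgebra} (hs : ‖s‖ ≤ 1) :
    ‖cesaroMean N s‖ ≤ 1 := by
  rw [cesaroMean, norm_smul, norm_inv, Complex.norm_natCast, inv_mul_le_iff₀ (by positivity),
    mul_one]
  refine (norm_sum_le _ _).trans ((Finset.sum_le_card_nsmul _ _ 1 fun k _ => ?_).trans ?_)
  · simpa using norm_pow_le_of_le hs k
  · simp

theorem star_kernelMean (C : ℝ) (a : M.toStarSubalgebra) (N : ℕ) :
    star (kernelMean C (star a) a N) = kernelMean C (star a) a N := by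
  simp [kernelMean, cesaroMean, star_sum, star_pow, star_smul, -Nat.cast_add]

theorem norm_kernelMean_le {C : ℝ} (hC : 0 < C) {a : M.toStarSubalgebra} (ha : ‖a‖ ^ 2 ≤ C)
    (N : ℕ) : ‖kernelMean C (star a) a N‖ ≤ 1 := by
  have := isClosed_coe_vonNeumannAlgebra M
  exact norm_cesaroMean_le N (norm_one_sub_smul_star_mul_self_le hC a ha)

theorem norm_mul_kernelMean_sq_le {C : ℝ} (hC : 0 < C) {a : M.toStarSubalgebra}
    (ha : ‖a‖ ^ 2 ≤ C) (N : ℕ) :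
    ‖a * kernelMean C (star a) a N‖ ^ 2 ≤ 2 * C / (N + 1) := by
  have := isClosed_coe_vonNeumannAlgebra M
  have hs := norm_one_sub_smul_star_mul_self_le hC a ha
  have hsN := norm_pow_le_of_le hs (N + 1)
  have h1 := norm_one_le M
  rw [one_pow] at hsN
  rw [sq, ← CStarRing.norm_star_mul_self, star_mul, star_kernelMean, mul_assoc,
    ← mul_assoc (star a)]
  refine (norm_mul_le _ _).trans
    ((mul_le_of_le_one_left (norm_nonneg _) (norm_kernelMean_le hC ha N)).trans ?_)
  rw [mul_kernelMean hC, norm_smul, Complex.norm_real, Real.norm_of_nonneg (by positivity)]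
  refine (mul_le_mul_of_nonneg_left (b := _) (c := 2)
    ((norm_sub_le _ _).trans (by linarith)) (by positivity)).trans (le_of_eq (by ring))

theorem tendsto_norm_mul_kernelMean {C : ℝ} (hC : 0 < C) {a : M.toStarSubalgebra}
    (ha : ‖a‖ ^ 2 ≤ C) :
    Filter.Tendsto (fun N => ‖a * kernelMean C (star a) a N‖) Filter.atTop (nhds 0) := by
  have h1 : Filter.Tendsto (fun N : ℕ => √(2 * C / (N + 1))) Filter.atTop (nhds 0) := by
    rw [← Real.sqrt_zero]
    refine (Real.continuous_sqrt.tendsto 0).comp ?_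
    have := (tendsto_one_div_add_atTop_nhds_zero_nat (𝕜 := ℝ)).const_mul (2 * C)
    simpa [div_eq_mul_inv] using this
  exact squeeze_zero (fun N => norm_nonneg _)
    (fun N => Real.le_sqrt_of_sq_le (norm_mul_kernelMean_sq_le hC ha N)) h1

namespace TracialState

variable (τ : TracialState M)

theorem apply_aeval_mul_comm (x y : M.toStarSubalgebra) (p : Polynomial ℂ) :
    τ.toLinearMap (Polynomial.aeval (x * y) p) = τ.toLinearMap (Polynomial.aeval (y * x) p) := by
  induction p using Polynomial.induction_on' with
  | add p q hp hq => rw [_root_.map_add, _root_.map_add, _root_.map_add, _root_.map_add, hp, hq]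
  | monomial m c =>
    rw [Polynomial.aeval_monomial, Polynomial.aeval_monomial, ← Algebra.smul_def,
      ← Algebra.smul_def, map_smul, map_smul]
    congr 1
    cases m with
    | zero => rw [pow_zero, pow_zero]
    | succ m =>
      have h : y * (x * y) ^ m = (y * x) ^ m * y :=
        (SemiconjBy.pow_right (show SemiconjBy y (x * y) (y * x) from (mul_assoc _ _ _).symm) m).eq
      rw [pow_succ', pow_succ, mul_assoc, h, τ.tracial, mul_assoc]

/-- The kernel projections of `a` and of `a*` have equal trace; here, this is stated for their
approximations. -/
theorem apply_kernelMean_mul_self (C : ℝ) (x y : M.toStarSubalgebra) (N : ℕ) :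
    τ.toLinearMap (kernelMean C x y N * kernelMean C x y N) =
      τ.toLinearMap (kernelMean C y x N * kernelMean C y x N) := by
  have h : ∀ x y : M.toStarSubalgebra, kernelMean C x y N =
      Polynomial.aeval (x * y) (kernelMean C 1 (Polynomial.X : Polynomial ℂ) N) := fun x y => by
    simp [kernelMean, map_cesaroMean]
  rw [h x y, h y x, ← map_mul, ← map_mul, apply_aeval_mul_comm]

end TracialState

/-! ### Lowering the degree -/

/-- A pointwise bounded sequence of functionals has a pointwise limit along any ultrafilter. -/
theorem exists_linearMap_tendsto_ultrafilter {ι E : Type*} [AddCommGroup E] [Module ℂ E]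
    (U : Ultrafilter ι) (f : ι → E →ₗ[ℂ] ℂ) (hf : ∀ x, ∃ K : ℝ, ∀ i, ‖f i x‖ ≤ K) :
    ∃ φ : E →ₗ[ℂ] ℂ, ∀ x, Filter.Tendsto (fun i => f i x) U (nhds (φ x)) := by
  have h : ∀ x, ∃ c : ℂ, Filter.Tendsto (fun i => f i x) U (nhds c) := by
    intro x
    obtain ⟨K, hK⟩ := hf x
    obtain ⟨c, -, hc⟩ := (isCompact_closedBall (0 : ℂ) K).ultrafilter_le_nhds
      (U.map fun i => f i x) (Filter.le_principal_iff.mpr (Filter.Eventually.of_forall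
        (p := fun i => f i x ∈ Metric.closedBall (0 : ℂ) K) fun i => by simpa using hK i))
    exact ⟨c, hc⟩
  choose φ hφ using h
  refine ⟨{ toFun := φ, map_add' := fun x y => ?_, map_smul' := fun c x => ?_ }, hφ⟩
  · refine tendsto_nhds_unique (hφ (x + y)) ?_
    simpa using (hφ x).add (hφ y)
  · refine tendsto_nhds_unique (hφ (c • x)) ?_
    simpa using (hφ x).const_mul c

variable {τ : TracialState M} {X : Fin n → M.toStarSubalgebra}

/-- If `P(X) w = 0` with `w ≠ 0`, then there is a functional `φ` that does not vanish at `1` and for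
which all slices `(φ ⊗ id)(∂ⱼ P)` are again annihilated by `w`. It is a limit of `τ(q ·)` for
approximations `q` of the projection onto the kernel of `P(X)*`. -/
theorem exists_functional_ev_sliceLeft_mul_eq_zero (hX : ∀ i, IsSelfAdjoint (X i))
    {ξ : Fin n → τ.L2} (hξ : ∀ j, τ.IsConjugateVariable X j (ξ j)) (P : NCPoly n)
    {w : M.toStarSubalgebra} (hw : w ≠ 0) (hPw : ev X P * w = 0) :
    ∃ φ : NCPoly n →ₗ[ℂ] ℂ, φ 1 ≠ 0 ∧ ∀ j, ev X (sliceLeft j φ P) * w = 0 := by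
  set a := ev X P with ha
  set C : ℝ := ‖a‖ ^ 2 + 1 with hCdef
  have hC : 0 < C := by positivity
  have haC : ‖a‖ ^ 2 ≤ C := by rw [hCdef]; linarith
  have haC' : ‖star a‖ ^ 2 ≤ C := by rwa [norm_star]
  set b : ℕ → NCPoly n := kernelMean C (ncStar P) P with hb
  set c : ℕ → NCPoly n := kernelMean C P (ncStar P) with hc
  have evb : ∀ N, ev X (b N) = kernelMean C (star a) a N := fun N => by
    rw [hb, map_kernelMean, ev_ncStar hX]
  have evc : ∀ N, ev X (c N) = kernelMean C (star (star a)) (star a) N := fun N => by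
    rw [hc, map_kernelMean, ev_ncStar hX, star_star]
  have normb : ∀ N, ‖ev X (b N)‖ ≤ 1 := fun N => by
    rw [evb]; exact norm_kernelMean_le hC haC N
  have normc : ∀ N, ‖ev X (c N)‖ ≤ 1 := fun N => by
    rw [evc]; exact norm_kernelMean_le hC haC' N
  have normcc : ∀ N, ‖ev X (c N * c N)‖ ≤ 1 := fun N => by
    rw [map_mul]
    exact (norm_mul_le _ _).trans (mul_le_one₀ (normc N) (norm_nonneg _) (normc N))
  have limb : Filter.Tendsto (fun N => ‖a * ev X (b N)‖) Filter.atTop (nhds 0) := by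
    simpa only [evb] using tendsto_norm_mul_kernelMean hC haC
  have limc : Filter.Tendsto (fun N => ‖ev X (c N) * a‖) Filter.atTop (nhds 0) := by
    have h := tendsto_norm_mul_kernelMean hC haC'
    refine h.congr fun N => ?_
    rw [← norm_star, star_mul, star_kernelMean, star_star, evc, star_star]
  have bw : ∀ N, ev X (b N) * w = w := fun N => by
    rw [evb]; exact kernelMean_mul C hPw N
  -- The traces of `c N * c N` are bounded below since `b N` fixes `w`.
  have hlow : ∀ N, (‖τ.toL2 w‖ / ‖w‖) ^ 2 ≤ ‖τ.distribution X (c N * c N * 1)‖ := by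
    intro N
    have h1 : τ.distribution X (c N * c N * 1) =
        τ.toLinearMap (star (ev X (b N)) * ev X (b N)) := by
      rw [mul_one, TracialState.distribution_apply, map_mul, evc, star_star,
        τ.apply_kernelMean_mul_self, evb, star_kernelMean]
    have h2 := τ.norm_toL2_mul_le' (ev X (b N)) w
    rw [bw, ← div_le_iff₀ (norm_pos_iff.mpr hw)] at h2
    rw [h1]
    refine (pow_le_pow_left₀ (by positivity) h2 2).trans ?_
    rw [τ.norm_toL2_sq]
    exact Complex.re_le_norm _
  obtain ⟨φ, hφ⟩ := exists_linearMap_tendsto_ultrafilter (Filter.hyperfilter ℕ)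
    (fun N => mulLeftFunctional (τ.distribution X) (c N * c N)) (fun R => ⟨‖ev X R‖, fun N => by
      rw [mulLeftFunctional_apply, TracialState.distribution_apply, map_mul (ev X)]
      exact (τ.norm_apply_le _).trans ((norm_mul_le _ _).trans
        (mul_le_of_le_one_left (norm_nonneg _) (normcc N)))⟩)
  have hU : (Filter.hyperfilter ℕ : Filter ℕ) ≤ Filter.atTop := Nat.hyperfilter_le_atTop
  refine ⟨φ, fun h0 => ?_, fun j => ?_⟩
  · have h1 := ge_of_tendsto' (hφ 1).norm hlow
    rw [h0, norm_zero] at h1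
    have h2 : 0 < ‖τ.toL2 w‖ := norm_pos_iff.mpr fun h => hw (τ.toL2_eq_zero h)
    have h3 : 0 < ‖w‖ := norm_pos_iff.mpr hw
    have : 0 < (‖τ.toL2 w‖ / ‖w‖) ^ 2 := by positivity
    linarith
  set R := sliceLeft j φ P with hR
  -- The estimate for `Q₁ = c N * c N`, whose term with `Q₁ P` disappears in the limit.
  have hbound : ∀ Q : NCPoly n, ‖τ.distribution X (R * Q)‖ ≤
      3 * ‖ξ j‖ * ‖τ.toL2 (ev X (P * Q))‖ := by
    intro Q
    have e : ∀ χ : NCPoly n →ₗ[ℂ] ℂ, τ.distribution X (sliceLeft j χ P * Q) =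
        χ (sliceRight j (mulRightFunctional (τ.distribution X) Q) P) := fun χ => by
      rw [← apply_sliceLeft, mulRightFunctional_apply]
    have h1 := (hφ (sliceRight j (mulRightFunctional (τ.distribution X) Q) P)).norm
    rw [← e φ] at h1
    have h2 : Filter.Tendsto (fun N => 3 * ‖ξ j‖ * ‖τ.toL2 (ev X (P * Q))‖ +
        2 * ‖ξ j‖ * (‖ev X Q‖ * ‖ev X (c N) * a‖)) (Filter.hyperfilter ℕ)
        (nhds (3 * ‖ξ j‖ * ‖τ.toL2 (ev X (P * Q))‖ + 2 * ‖ξ j‖ * (‖ev X Q‖ * 0))) :=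
      (((limc.mono_left hU).const_mul _).const_mul _).const_add _
    rw [mul_zero, mul_zero, add_zero] at h2
    refine le_of_tendsto_of_tendsto' h1 h2 fun N => ?_
    rw [← e]
    refine (TracialState.norm_distribution_sliceLeft_mul_le hX (hξ j) P (c N * c N) Q).trans
      (add_le_add (mul_le_mul_of_nonneg_left
        (mul_le_of_le_one_left (norm_nonneg _) (normcc N)) (by positivity)) ?_)
    refine mul_le_mul_of_nonneg_left (mul_le_mul_of_nonneg_left ?_ (norm_nonneg _))
      (by positivity)
    rw [mul_assoc, map_mul, map_mul (ev X) (c N) P]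
    exact (τ.norm_toL2_le _).trans ((norm_mul_le _ _).trans
      (mul_le_of_le_one_left (norm_nonneg _) (normc N)))
  -- Testing against `Q = b N * (R * b N)*` turns the left side into an `L²` norm.
  have hsq : ∀ N, ‖τ.toL2 (ev X R * ev X (b N))‖ ^ 2 ≤
      3 * ‖ξ j‖ * (‖a * ev X (b N)‖ * ‖ev X R‖) := by
    intro N
    have h1 := hbound (b N * ncStar (R * b N))
    rw [← mul_assoc, TracialState.distribution_apply, map_mul, ev_ncStar hX, map_mul (ev X) R,
      ← mul_assoc P, map_mul (ev X) (P * b N), map_mul (ev X) P, ev_ncStar hX,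
      map_mul (ev X) R] at h1
    rw [← τ.norm_toL2_star, τ.norm_toL2_sq, star_star]
    refine (Complex.re_le_norm _).trans (h1.trans
      (mul_le_mul_of_nonneg_left ((τ.norm_toL2_le _).trans ((norm_mul_le _ _).trans
        (mul_le_mul_of_nonneg_left ?_ (norm_nonneg _)))) (by positivity)))
    rw [norm_star]
    exact (norm_mul_le _ _).trans (mul_le_of_le_one_right (norm_nonneg _) (normb N))
  have hsq' : ∀ N, ‖τ.toL2 (ev X R * w)‖ ^ 2 ≤
      3 * ‖ξ j‖ * (‖a * ev X (b N)‖ * ‖ev X R‖) * ‖w‖ ^ 2 := by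
    intro N
    have h1 := τ.norm_toL2_mul_le' (ev X R * ev X (b N)) w
    rw [mul_assoc, bw] at h1
    refine (pow_le_pow_left₀ (norm_nonneg _) h1 2).trans ?_
    rw [mul_pow]
    exact mul_le_mul_of_nonneg_right (hsq N) (by positivity)
  have hlim := (((limb.mul_const ‖ev X R‖).const_mul (3 * ‖ξ j‖)).mul_const (‖w‖ ^ 2))
  rw [zero_mul, mul_zero, zero_mul] at hlim
  have h0 := le_antisymm (ge_of_tendsto' hlim hsq') (sq_nonneg _)
  exact τ.toL2_eq_zero (norm_eq_zero.mp (pow_eq_zero_iff two_ne_zero |>.mp h0))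

theorem eq_zero_of_degreeLT_of_ev_mul_eq_zero (hX : ∀ i, IsSelfAdjoint (X i))
    {ξ : Fin n → τ.L2} (hξ : ∀ j, τ.IsConjugateVariable X j (ξ j)) {w : M.toStarSubalgebra}
    (hw : w ≠ 0) (d : ℕ) {P : NCPoly n} (hP : DegreeLT d P) (hPw : ev X P * w = 0) : P = 0 := by
  induction d generalizing P with
  | zero => exact hP
  | succ d ih =>
    obtain ⟨φ, hφ, hφP⟩ := exists_functional_ev_sliceLeft_mul_eq_zero hX hξ P hw hPw
    have h0 : ∀ j, sliceLeft j φ P = 0 := fun j => ih (hP.sliceLeft j φ) (hφP j)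
    cases d with
    | zero =>
      obtain ⟨c, R, hR, rfl⟩ := hP
      have hR0 : ∀ i, R i = 0 := hR
      simp only [hR0, mul_zero, Finset.sum_const_zero, add_zero] at hPw ⊢
      rw [AlgHom.commutes, ← Algebra.smul_def, smul_eq_zero] at hPw
      rw [hPw.resolve_right hw, map_zero]
    | succ d => exact ih (hP.of_sliceLeft_eq_zero hφ h0) hPw

theorem eq_zero_of_ev_mul_eq_zero (hX : ∀ i, IsSelfAdjoint (X i))
    (hfin : fisherInformation τ X < ⊤) {P : NCPoly n} (hP : P ≠ 0) {w : M.toStarSubalgebra}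
    (hPw : ev X P * w = 0) : w = 0 := by
  by_cases h : ∃ ξ : Fin n → τ.L2, IsConjugateSystem τ X ξ
  · obtain ⟨ξ, hξ⟩ := h
    have hξ' : ∀ j, τ.IsConjugateVariable X j (ξ j) := fun j Q =>
      (τ.tensor_ncDeriv X j Q).symm.trans (hξ.relations Q j)
    obtain ⟨d, hd⟩ := exists_degreeLT P
    by_contra hw
    exact hP (eq_zero_of_degreeLT_of_ev_mul_eq_zero hX hξ' hw d hd hPw)
  · rw [fisherInformation, dif_neg h] at hfin
    exact absurd hfin (lt_irrefl _)

end FreeFisher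

end

theorem mainTheorem2 {H : Type*} [NormedAddCommGroup H] [InnerProductSpace ℂ H] [CompleteSpace H]
    (M : VonNeumannAlgebra H) (τ : FreeFisher.TracialState M) (n : ℕ)
    (X : Fin n → M.toStarSubalgebra) (hX : ∀ i, IsSelfAdjoint (X i))
    (hfin : FreeFisher.fisherInformation τ X < ⊤)
    (P : FreeFisher.NCPoly n) (hP : P ≠ 0) :
    (¬ ∃ w : M.toStarSubalgebra,
        (w : H →L[ℂ] H) ∈ FreeFisher.vNGen (Set.range fun i => (X i : H →L[ℂ] H)) ∧
        IsSelfAdjoint w ∧ w ≠ 0 ∧ FreeFisher.ev X P * w = 0) ∧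
    (∀ w : M.toStarSubalgebra,
        (w : H →L[ℂ] H) ∈ FreeFisher.vNGen (Set.range fun i => (X i : H →L[ℂ] H)) →
        FreeFisher.ev X P * w = 0 → w = 0) :=
  ⟨fun ⟨_, _, _, hw, h⟩ => hw (FreeFisher.eq_zero_of_ev_mul_eq_zero hX hfin hP h),
    fun _ _ h => FreeFisher.eq_zero_of_ev_mul_eq_zero hX hfin hP h⟩
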